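/- All matroids and lattices are finite. A flat $X$ of a matroid $M$ is \emph{cyclic} if the restriction $M|X$ has no isthmuses (coloops); ordered by inclusion, the cyclic flats of $M$ form a lattice $\mathcal{Z}(M)$. A matroid $M$ with ground set $E$ is \emph{transversal} if there is a finite family $(A_1,\ldots,A_n)$ of subsets of $E$ whose partial transversals are exactly the independent sets of $M$. A lattice $L$ is a \emph{Tr-lattice} if every matroid $M$ with $\mathcal{Z}(M)\cong L$ is transversal. An element $y$ of $L$ is a \emph{cover} of $x$ if $x<y$ and there is no $z\in L$ with $x<z<y$. \textbf{Theorem.} Each element of a Tr-lattice has at most two covers. -/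

import Mathlib

universe u v

namespace Matroid

variable {α : Type u}

/-- A flat `X` of `M` is cyclic if the restriction of `M` to `X` has no isthmuses (coloops). -/
def IsCyclicFlat (M : Matroid α) (X : Set α) : Prop :=
  M.IsFlat X ∧ ∀ e, ¬ (M ↾ X).IsColoop e

/-- The collection of cyclic flats of `M`. As a subtype of `Set α` it is ordered by inclusion;
for this order it is a lattice. -/
abbrev CyclicFlats (M : Matroid α) : Type u := {X : Set α // M.IsCyclicFlat X}

/-- `I` is a partial transversal of the family `A` of sets: distinct elements of `I` can be
assigned distinct indices so that each `x ∈ I` lies in the set with the index of `x`. -/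
def IsPartialTransversal {ι : Type*} (A : ι → Set α) (I : Set α) : Prop :=
  ∃ f : I → ι, Function.Injective f ∧ ∀ x : I, (x : α) ∈ A (f x)

/-- `M` is transversal: for some finite family of subsets of the ground set, the independent sets
of `M` are exactly the partial transversals of the family. -/
def IsTransversal (M : Matroid α) : Prop :=
  ∃ (n : ℕ) (A : Fin n → Set α), (∀ i, A i ⊆ M.E) ∧
    ∀ I : Set α, M.Indep I ↔ IsPartialTransversal A I

end Matroid

/-- A lattice `L` is a Tr-lattice if every (finite) matroid whose lattice of cyclic flats is
isomorphic to `L` is transversal. Since the matroids are finite, the choice of the universe `v`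
in which their ground sets live is immaterial. -/
def IsTrLattice (L : Type u) [Lattice L] : Prop :=
  ∀ (α : Type v) (M : Matroid α), M.Finite →
    Nonempty (L ≃o M.CyclicFlats) → M.IsTransversal

/-! Let `x` have three covers. A strictly increasing submodular `r` on `L` with `r ⊥ = 0` gives a
matroid with lattice of cyclic flats `L`, by placing many points freely at each element
(`labelMatroid`). If it has a presentation, let `N z` index the members that meet the nonloops below
`z`. Then `N z` has at most `r z` elements (`ncard_nbrs_le_rank`) and `N y ∪ N z` at least `r (y ⊔
z)` (`rank_sup_le_ncard_nbrs_union`). Inclusion-exclusion for three elements then bounds the sum of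
the ranks of their pairwise joins by `r ⊤` plus the sum of their ranks
(`not_isTransversal_of_rank`). The height above `x` truncated at two violates this at the covers, as
2 + 2 + 2 > 2 + 1 + 1 + 1. A large multiple of it, perturbed by `numNotAbove` to become strictly
increasing, still does. -/

namespace Matroid

/-! ### Hall's condition for partial transversals -/

section Neighbours

variable {α : Type u} {ι : Type*}

/-- The indices of the members of the family `A` that meet `X`. -/
def nbrs (A : ι → Set α) (X : Set α) : Set ι := {i | (A i ∩ X).Nonempty}

lemma nbrs_mono (A : ι → Set α) {X Y : Set α} (h : X ⊆ Y) : nbrs A X ⊆ nbrs A Y :=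
  fun _ hi => hi.mono (Set.inter_subset_inter_right _ h)

lemma isPartialTransversal_iff_hall [Finite α] [Finite ι] (A : ι → Set α) (I : Set α) :
    IsPartialTransversal A I ↔ ∀ Y ⊆ I, Y.ncard ≤ (nbrs A Y).ncard := by
  classical
  have := Fintype.ofFinite ι
  constructor
  · rintro ⟨f, hf, hfA⟩ Y hY
    have h : (fun y : Y => f ⟨y, hY y.2⟩) '' Set.univ ⊆ nbrs A Y := by
      rintro _ ⟨y, -, rfl⟩
      exact ⟨y, hfA ⟨y, hY y.2⟩, y.2⟩
    have hinj : Function.Injective (fun y : Y => f ⟨y, hY y.2⟩) := by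
      intro y z hyz
      have := hf hyz
      exact Subtype.ext (congrArg (fun w : I => (w : α)) this)
    have := Set.ncard_le_ncard h
    rwa [Set.ncard_image_of_injective _ hinj, Set.ncard_univ, Nat.card_coe_set_eq] at this
  · intro h
    have hall : ∀ s : Finset I, s.card ≤
        (s.biUnion fun x : I => Finset.univ.filter fun i => (x : α) ∈ A i).card := by
      intro s
      have h1 := h ((fun x : I => (x : α)) '' (s : Set I)) (by rintro _ ⟨x, -, rfl⟩; exact x.2)
      rw [Set.ncard_image_of_injective _ Subtype.val_injective, Set.ncard_coe_finset] at h1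
      refine h1.trans ?_
      rw [← Set.ncard_coe_finset]
      refine Set.ncard_le_ncard ?_
      rintro i ⟨a, ha, x, hx, rfl⟩
      simp only [Finset.coe_biUnion, Set.mem_iUnion, Finset.mem_coe]
      exact ⟨x, hx, by simpa using ha⟩
    obtain ⟨f, hf, hfA⟩ := (Finset.all_card_le_biUnion_card_iff_exists_injective _).1 hall
    exact ⟨f, hf, fun x => by simpa using hfA x⟩

/-- A circuit can violate Hall's condition only at the whole of itself. -/
lemma ncard_nbrs_lt_of_forall_ssubset [Finite α] [Finite ι] (A : ι → Set α) {C : Set α}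
    (hC : ¬ IsPartialTransversal A C) (hss : ∀ Y ⊂ C, IsPartialTransversal A Y) :
    (nbrs A C).ncard < C.ncard := by
  rw [isPartialTransversal_iff_hall] at hC
  push Not at hC
  obtain ⟨Y, hY, hlt⟩ := hC
  rcases hY.eq_or_ssubset with rfl | hY
  · exact hlt
  · exact absurd ((isPartialTransversal_iff_hall A Y).1 (hss Y hY) Y subset_rfl) hlt.not_ge

end Neighbours

/-! ### Independence from a labelling, and tight elements -/

section Labelled

variable {α : Type v} {L : Type u} [Lattice L]

/-- A set is independent for a labelling `π` of the points by elements of a lattice with a rank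
function `r` if for each `z` it has at most `r z` points with label below `z`. -/
def LabelIndep (π : α → L) (r : L → ℕ) (I : Set α) : Prop :=
  ∀ z, (I ∩ π ⁻¹' Set.Iic z).ncard ≤ r z

/-- `z` is tight for `I` if `I` has exactly `r z` points with label below `z`. -/
def IsTight (π : α → L) (r : L → ℕ) (I : Set α) (z : L) : Prop :=
  (I ∩ π ⁻¹' Set.Iic z).ncard = r z

lemma LabelIndep.ncard_le_top [OrderTop L] {π : α → L} {r : L → ℕ} {I : Set α}
    (hI : LabelIndep π r I) : I.ncard ≤ r ⊤ := by
  simpa using hI ⊤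

variable [Finite α] {π : α → L} {r : L → ℕ}

lemma LabelIndep.subset {I J : Set α} (hJ : LabelIndep π r J) (h : I ⊆ J) : LabelIndep π r I :=
  fun z => (Set.ncard_le_ncard (Set.inter_subset_inter_left _ h)).trans (hJ z)

/-- The number of points of `I` below an element is supermodular and bounded by the submodular `r`,
so equality at `z` and `w` forces equality at their join. -/
lemma LabelIndep.isTight_sup (hsub : ∀ z w, r (z ⊔ w) + r (z ⊓ w) ≤ r z + r w) {I : Set α}
    (hI : LabelIndep π r I) {z w : L} (hz : IsTight π r I z) (hw : IsTight π r I w) :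
    IsTight π r I (z ⊔ w) := by
  have h1 := Set.ncard_union_add_ncard_inter (I ∩ π ⁻¹' Set.Iic z) (I ∩ π ⁻¹' Set.Iic w)
  have h2 : ((I ∩ π ⁻¹' Set.Iic z) ∪ (I ∩ π ⁻¹' Set.Iic w)).ncard ≤
      (I ∩ π ⁻¹' Set.Iic (z ⊔ w)).ncard := by
    refine Set.ncard_le_ncard ?_
    rintro a (⟨h, h'⟩ | ⟨h, h'⟩)
    · exact ⟨h, le_trans h' le_sup_left⟩
    · exact ⟨h, le_trans h' le_sup_right⟩
  have h3 : ((I ∩ π ⁻¹' Set.Iic z) ∩ (I ∩ π ⁻¹' Set.Iic w)).ncard ≤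
      (I ∩ π ⁻¹' Set.Iic (z ⊓ w)).ncard := by
    refine Set.ncard_le_ncard ?_
    rintro a ⟨⟨h, h'⟩, -, h''⟩
    exact ⟨h, le_inf h' h''⟩
  have h4 := hI (z ⊔ w)
  have h5 := hI (z ⊓ w)
  have h6 := hsub z w
  unfold IsTight at *
  omega

/-- A new point breaks exactly the tight constraints above its label; one exists iff `t` is one. -/
lemma LabelIndep.insert_iff {I : Set α} (hI : LabelIndep π r I) {t : L} (ht : IsTight π r I t)
    (hmax : ∀ z, IsTight π r I z → z ≤ t) {e : α} (he : e ∉ I) :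
    LabelIndep π r (insert e I) ↔ ¬ π e ≤ t := by
  have key : ∀ z, π e ≤ z → (insert e I ∩ π ⁻¹' Set.Iic z).ncard =
      (I ∩ π ⁻¹' Set.Iic z).ncard + 1 := by
    intro z hz
    rw [Set.insert_inter_of_mem (show e ∈ π ⁻¹' Set.Iic z from hz), Set.ncard_insert_of_notMem]
    exact fun h => he h.1
  constructor
  · intro h het
    have h1 := h t
    rw [key t het, ht] at h1
    omega
  · intro het z
    by_cases hz : π e ≤ z
    · rw [key z hz]
      refine Nat.lt_of_le_of_ne (hI z) fun hzt => het (hz.trans (hmax z hzt))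
    · rw [Set.insert_inter_of_notMem (show e ∉ π ⁻¹' Set.Iic z from hz)]
      exact hI z

variable [BoundedOrder L]

lemma LabelIndep.exists_greatest_isTight [Finite L] (h0 : r ⊥ = 0)
    (hsub : ∀ z w, r (z ⊔ w) + r (z ⊓ w) ≤ r z + r w) {I : Set α} (hI : LabelIndep π r I) :
    ∃ t, IsTight π r I t ∧ ∀ z, IsTight π r I z → z ≤ t := by
  have hne : {z | IsTight π r I z}.Nonempty :=
    ⟨⊥, le_antisymm (hI ⊥) (by rw [h0]; exact Nat.zero_le _)⟩
  obtain ⟨t, ht⟩ := (Set.toFinite {z | IsTight π r I z}).exists_maximal hne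
  exact ⟨t, ht.1, fun z hz => le_sup_left.trans
    (ht.2 (hI.isTight_sup hsub hz ht.1) le_sup_right)⟩

/-- If no point of `J` can be added, all of `J \ I` lies below the greatest tight `t`. There `I`
already has the maximal number `r t` of points, so `J` is no larger than `I`. -/
lemma LabelIndep.exists_insert [Finite L] (h0 : r ⊥ = 0)
    (hsub : ∀ z w, r (z ⊔ w) + r (z ⊓ w) ≤ r z + r w) {I J : Set α} (hI : LabelIndep π r I)
    (hJ : LabelIndep π r J) (hlt : I.ncard < J.ncard) :
    ∃ e ∈ J, e ∉ I ∧ LabelIndep π r (insert e I) := by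
  obtain ⟨t, ht, hmax⟩ := hI.exists_greatest_isTight h0 hsub
  by_contra! hcon
  have hJt : ∀ e ∈ J, e ∉ I → π e ≤ t := fun e heJ heI => by
    by_contra h
    exact hcon e heJ heI ((hI.insert_iff ht hmax heI).2 h)
  have h1 : (J \ π ⁻¹' Set.Iic t).ncard ≤ (I \ π ⁻¹' Set.Iic t).ncard := by
    refine Set.ncard_le_ncard ?_
    rintro e ⟨heJ, het⟩
    by_contra h
    exact het (hJt e heJ fun heI => h ⟨heI, het⟩)
  have h2 := Set.ncard_inter_add_ncard_sdiff_eq_ncard I (π ⁻¹' Set.Iic t)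
  have h3 := Set.ncard_inter_add_ncard_sdiff_eq_ncard J (π ⁻¹' Set.Iic t)
  have h4 := hJ t
  unfold IsTight at ht
  omega

lemma le_of_subset_union_of_lt_ncard {I X : Set α} (hI : LabelIndep π r I) {t w : L}
    (hX : X ⊆ I ∪ π ⁻¹' Set.Iic t) (hw : r ⊤ < (X ∩ π ⁻¹' {w}).ncard) : w ≤ t := by
  obtain ⟨e, ⟨heX, hew⟩, heI⟩ := Set.exists_mem_notMem_of_ncard_lt_ncard
    (hI.ncard_le_top.trans_lt hw)
  have hew : π e = w := hew
  rcases hX heX with h | h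
  · exact absurd h heI
  · exact hew ▸ h

/-- The points labelled below `z` but not by `⊥`. -/
def nonbotBelow (π : α → L) (z : L) : Set α := {a | π a ≤ z ∧ π a ≠ ⊥}

lemma LabelIndep.label_ne_bot {I : Set α} (h0 : r ⊥ = 0) (hI : LabelIndep π r I) {e : α}
    (he : e ∈ I) : π e ≠ ⊥ := by
  intro h
  have h1 := hI ⊥
  rw [h0, Nat.le_zero, Set.ncard_eq_zero] at h1
  exact Set.notMem_empty e (h1 ▸ ⟨he, h.le⟩)

/-- In a presentation of the matroid, the points labelled below `z` meet at most `r z` sets. -/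
lemma ncard_nbrs_le_rank {ι : Type*} [Finite ι] {A : ι → Set α} (h0 : r ⊥ = 0)
    (hA : ∀ I, LabelIndep π r I ↔ IsPartialTransversal A I)
    (hr : StrictMono r) (hπ : ∀ z, r ⊤ + 1 < (π ⁻¹' {z}).ncard) (z : L) :
    (nbrs A (nonbotBelow π z)).ncard ≤ r z := by
  obtain ⟨I, hIz, hIc⟩ := Set.exists_subset_card_eq
    (show r z ≤ (π ⁻¹' {z}).ncard from
      (hr.monotone le_top).trans ((Nat.le_succ _).trans (hπ z).le))
  have hIz' : ∀ e ∈ I, π e = z := fun e he => hIz he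
  -- At `u` not above `z` only `e` can count, and `r u` is positive once `u` is above a label other
  -- than `⊥`.
  have small : ∀ e ∈ nonbotBelow π z, ∀ Y ⊆ insert e I, Y.ncard ≤ r z → LabelIndep π r Y := by
    intro e he Y hY hYc u
    by_cases hu : z ≤ u
    · exact (Set.ncard_le_ncard Set.inter_subset_left).trans (hYc.trans (hr.monotone hu))
    · have hYe : Y ∩ π ⁻¹' Set.Iic u ⊆ {e} := by
        rintro a ⟨ha, hau⟩
        rcases hY ha with h | h
        · exact h
        · exact absurd (hIz' a h ▸ hau) hu
      by_cases heu : π e ≤ u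
      · have h1 := Set.ncard_le_ncard hYe
        rw [Set.ncard_singleton] at h1
        have h2 : r ⊥ < r u := hr (bot_lt_iff_ne_bot.2 fun h => he.2 (le_bot_iff.1 (h ▸ heu)))
        omega
      · have : Y ∩ π ⁻¹' Set.Iic u = ∅ := by
          rw [Set.eq_empty_iff_forall_notMem]
          intro a ha
          exact heu ((hYe ha : a = e) ▸ ha.2)
        simp [this]
  -- `insert e I` is a circuit, so it has at most `r z` neighbours; the independent `I` already has
  -- that many.
  have hmain : ∀ e ∈ nonbotBelow π z, e ∉ I → (nbrs A (insert e I)).ncard ≤ r z ∧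
      nbrs A (insert e I) = nbrs A I := by
    intro e he heI
    have hcard : (insert e I).ncard = r z + 1 := by rw [Set.ncard_insert_of_notMem heI, hIc]
    have h1 : (nbrs A (insert e I)).ncard < (insert e I).ncard := by
      refine ncard_nbrs_lt_of_forall_ssubset A (fun h => ?_) fun Y hY => (hA Y).1 ?_
      · have h2 := ((hA _).2 h) z
        rw [Set.inter_eq_left.2, hcard] at h2
        · omega
        · rintro a (rfl | ha)
          · exact he.1
          · exact (hIz' a ha).le
      · refine small e he Y hY.subset ?_
        have := Set.ncard_lt_ncard hY
        omega
    have h2 := (isPartialTransversal_iff_hall A I).1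
      ((hA I).1 (small e he I (Set.subset_insert _ _) hIc.le)) I subset_rfl
    refine ⟨by omega, (Set.eq_of_subset_of_ncard_le (nbrs_mono A (Set.subset_insert _ _)) ?_).symm⟩
    omega
  rcases eq_or_ne z ⊥ with rfl | hz
  · have : nbrs A (nonbotBelow π (⊥ : L)) = ∅ := by
      rw [Set.eq_empty_iff_forall_notMem]
      rintro i ⟨a, -, ha, ha'⟩
      exact ha' (le_bot_iff.1 ha)
    simp [this]
  · obtain ⟨e, hez, heI⟩ := Set.exists_mem_notMem_of_ncard_lt_ncard
      (show I.ncard < (π ⁻¹' {z}).ncard by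
        have := hr.monotone (le_top : z ≤ ⊤); have := hπ z; omega)
    have hez : π e = z := hez
    obtain ⟨h1, h2⟩ := hmain e ⟨hez.le, by rwa [hez]⟩ heI
    rw [h2] at h1
    refine (Set.ncard_le_ncard ?_).trans h1
    rintro i ⟨a, hai, ha⟩
    by_cases haI : a ∈ I
    · exact ⟨a, hai, haI⟩
    · rw [← (hmain a ha haI).2]
      exact ⟨a, hai, Set.mem_insert _ _⟩

/-! ### The labelled matroid and its cyclic flats -/

/-- The matroid on a set of points labelled by a lattice with a submodular rank function. -/
def labelMatroid [Finite L] (π : α → L) (r : L → ℕ) (h0 : r ⊥ = 0)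
    (hsub : ∀ z w, r (z ⊔ w) + r (z ⊓ w) ≤ r z + r w) : Matroid α :=
  (IndepMatroid.ofFinite (E := Set.univ) Set.finite_univ (LabelIndep π r)
    (fun z => by simp) (fun _ _ hJ h => hJ.subset h)
    (fun _ _ hI hJ hlt => hI.exists_insert h0 hsub hJ hlt) (fun _ _ => Set.subset_univ _)).matroid

section

variable [Finite L] (h0 : r ⊥ = 0) (hsub : ∀ z w, r (z ⊔ w) + r (z ⊓ w) ≤ r z + r w)

lemma labelMatroid_indep {I : Set α} :
    (labelMatroid π r h0 hsub).Indep I ↔ LabelIndep π r I := Iff.rfl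

lemma labelMatroid_finite : (labelMatroid π r h0 hsub).Finite := ⟨Set.toFinite _⟩

lemma labelMatroid_closure {I : Set α} (hI : LabelIndep π r I) {t : L} (ht : IsTight π r I t)
    (hmax : ∀ z, IsTight π r I z → z ≤ t) :
    (labelMatroid π r h0 hsub).closure I = I ∪ π ⁻¹' Set.Iic t := by
  have hI' : (labelMatroid π r h0 hsub).Indep I := hI
  ext e
  by_cases he : e ∈ I
  · exact iff_of_true (Matroid.mem_closure_of_mem _ he (Set.subset_univ _)) (Or.inl he)
  · rw [hI'.mem_closure_iff_of_notMem he, ← Matroid.not_indep_iff (Set.subset_univ _),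
      labelMatroid_indep, hI.insert_iff ht hmax he, not_not]
    simp [he]

/-- A set of points labelled below `z`, with many points labelled `z`, spans the set of all points
labelled below `z`. -/
lemma labelMatroid_closure_eq_preimage_Iic (hr : StrictMono r) {X : Set α} {z : L}
    (hX : X ⊆ π ⁻¹' Set.Iic z) (hz : r ⊤ < (X ∩ π ⁻¹' {z}).ncard) :
    (labelMatroid π r h0 hsub).closure X = π ⁻¹' Set.Iic z := by
  obtain ⟨I, hI⟩ := (labelMatroid π r h0 hsub).exists_isBasis X (Set.subset_univ _)
  have hIi : LabelIndep π r I := hI.indep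
  obtain ⟨t, ht, hmax⟩ := hIi.exists_greatest_isTight h0 hsub
  have hcl := labelMatroid_closure h0 hsub hIi ht hmax
  have hIz : I ⊆ π ⁻¹' Set.Iic z := hI.subset.trans hX
  have hzt : z ≤ t := le_of_subset_union_of_lt_ncard hIi (hcl ▸ hI.subset_closure) hz
  have hle : r t ≤ r z := by
    rw [← ht]
    refine le_trans (Set.ncard_le_ncard ?_) (hIi z)
    exact fun e he => ⟨he.1, hIz he.1⟩
  obtain rfl : z = t := by
    by_contra hne
    exact (hr (lt_of_le_of_ne hzt hne)).not_ge hle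
  rw [← hI.closure_eq_closure, hcl, Set.union_eq_right.2 hIz]

/-- Each label has at least `r ⊤ + 2` points, so deleting one leaves enough to span: no point is a
coloop. -/
lemma labelMatroid_isCyclicFlat_preimage_Iic (hr : StrictMono r)
    (hπ : ∀ z, r ⊤ + 1 < (π ⁻¹' {z}).ncard) (z : L) :
    (labelMatroid π r h0 hsub).IsCyclicFlat (π ⁻¹' Set.Iic z) := by
  have hsubset : π ⁻¹' {z} ⊆ π ⁻¹' Set.Iic z := fun a ha => le_of_eq ha
  refine ⟨?_, fun e he => ?_⟩
  · rw [Matroid.isFlat_iff_closure_eq]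
    refine labelMatroid_closure_eq_preimage_Iic h0 hsub hr subset_rfl ?_
    rw [Set.inter_eq_right.2 hsubset]
    exact (Nat.lt_succ_self _).trans (hπ z)
  · rw [Matroid.restrict_isColoop_iff (Set.subset_univ _)] at he
    refine he.1 ?_
    rw [labelMatroid_closure_eq_preimage_Iic h0 hsub hr Set.sdiff_subset]
    · exact he.2
    · have h1 : π ⁻¹' {z} \ {e} ⊆ (π ⁻¹' Set.Iic z \ {e}) ∩ π ⁻¹' {z} :=
        fun a ha => ⟨⟨hsubset ha.1, ha.2⟩, ha.1⟩
      have h2 := Set.ncard_le_ncard h1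
      have h3 := Set.pred_ncard_le_ncard_sdiff_singleton (π ⁻¹' {z}) e
      have h4 := hπ z
      omega

lemma exists_eq_preimage_Iic_of_isCyclicFlat {X : Set α}
    (hX : (labelMatroid π r h0 hsub).IsCyclicFlat X) : ∃ z, X = π ⁻¹' Set.Iic z := by
  obtain ⟨I, hI⟩ := (labelMatroid π r h0 hsub).exists_isBasis X (Set.subset_univ _)
  have hIi : LabelIndep π r I := hI.indep
  obtain ⟨t, ht, hmax⟩ := hIi.exists_greatest_isTight h0 hsub
  have hcl := labelMatroid_closure h0 hsub hIi ht hmax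
  have hXe : X = I ∪ π ⁻¹' Set.Iic t := by
    rw [← hcl, hI.closure_eq_closure, hX.1.closure]
  refine ⟨t, hXe.trans (Set.union_eq_right.2 fun e he => ?_)⟩
  by_contra het
  -- A basis point `e` not below `t` is a coloop: `t` stays tight for `I \ {e}`, which thus spans `X
  -- \ {e}`.
  refine hX.2 e ((Matroid.restrict_isColoop_iff (Set.subset_univ _)).2 ⟨?_, hI.subset he⟩)
  have hI' : LabelIndep π r (I \ {e}) := hIi.subset Set.sdiff_subset
  obtain ⟨t', ht', hmax'⟩ := hI'.exists_greatest_isTight h0 hsub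
  have htt : t ≤ t' := by
    refine hmax' t ?_
    unfold IsTight at ht ⊢
    rw [← ht]
    congr 1
    ext a
    constructor
    · exact fun h => ⟨h.1.1, h.2⟩
    · refine fun h => ⟨⟨h.1, ?_⟩, h.2⟩
      rintro rfl
      exact het h.2
  have hsubcl : X \ {e} ⊆ (labelMatroid π r h0 hsub).closure (I \ {e}) := by
    rw [labelMatroid_closure h0 hsub hI' ht' hmax', hXe]
    rintro a ⟨ha | ha, hae⟩
    · exact Or.inl ⟨ha, hae⟩
    · exact Or.inr (le_trans ha htt)
  intro hmem
  exact hI.indep.notMem_closure_sdiff_of_mem he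
    ((Matroid.closure_subset_closure_of_subset_closure hsubcl) hmem)

lemma labelMatroid_nonempty_orderIso (hr : StrictMono r)
    (hπ : ∀ z, r ⊤ + 1 < (π ⁻¹' {z}).ncard) :
    Nonempty (L ≃o (labelMatroid π r h0 hsub).CyclicFlats) := by
  let f : L ↪o (labelMatroid π r h0 hsub).CyclicFlats := OrderEmbedding.ofMapLEIff
    (fun z => ⟨π ⁻¹' Set.Iic z, labelMatroid_isCyclicFlat_preimage_Iic h0 hsub hr hπ z⟩) (by
      intro z w
      refine ⟨fun h => ?_, fun h a ha => le_trans ha h⟩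
      obtain ⟨a, ha⟩ : (π ⁻¹' {z}).Nonempty :=
        (Set.ncard_pos).1 ((Nat.zero_le _).trans_lt (hπ z))
      have ha : π a = z := ha
      have h : π ⁻¹' Set.Iic z ⊆ π ⁻¹' Set.Iic w := h
      exact ha ▸ h (le_of_eq ha))
  refine ⟨RelIso.ofSurjective f ?_⟩
  rintro ⟨X, hX⟩
  obtain ⟨z, rfl⟩ := exists_eq_preimage_Iic_of_isCyclicFlat h0 hsub hX
  exact ⟨z, rfl⟩

/-! ### Obstruction to transversality -/

/-- A basis of the points below `y` or `z` has a tight element above `y ⊔ z`, hence at least `r (y ⊔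
z)` points; Hall's condition gives as many neighbours. -/
lemma rank_sup_le_ncard_nbrs_union {ι : Type*} [Finite ι] {A : ι → Set α} (h0 : r ⊥ = 0)
    (hsub : ∀ z w, r (z ⊔ w) + r (z ⊓ w) ≤ r z + r w)
    (hA : ∀ I, LabelIndep π r I ↔ IsPartialTransversal A I)
    (hr : StrictMono r) (hπ : ∀ z, r ⊤ + 1 < (π ⁻¹' {z}).ncard) (y z : L) :
    r (y ⊔ z) ≤ (nbrs A (nonbotBelow π y) ∪ nbrs A (nonbotBelow π z)).ncard := by
  obtain ⟨I, hI⟩ := (labelMatroid π r h0 hsub).exists_isBasis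
    (π ⁻¹' Set.Iic y ∪ π ⁻¹' Set.Iic z) (Set.subset_univ _)
  have hIi : LabelIndep π r I := hI.indep
  obtain ⟨t, ht, hmax⟩ := hIi.exists_greatest_isTight h0 hsub
  have hX := hI.subset_closure
  rw [labelMatroid_closure h0 hsub hIi ht hmax] at hX
  have hy : y ≤ t := by
    refine le_of_subset_union_of_lt_ncard hIi (Set.subset_union_left.trans hX) ?_
    rw [Set.inter_eq_right.2 (show π ⁻¹' {y} ⊆ π ⁻¹' Set.Iic y from fun a ha => le_of_eq ha)]
    exact (Nat.lt_succ_self _).trans (hπ y)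
  have hz : z ≤ t := by
    refine le_of_subset_union_of_lt_ncard hIi (Set.subset_union_right.trans hX) ?_
    rw [Set.inter_eq_right.2 (show π ⁻¹' {z} ⊆ π ⁻¹' Set.Iic z from fun a ha => le_of_eq ha)]
    exact (Nat.lt_succ_self _).trans (hπ z)
  calc r (y ⊔ z) ≤ r t := hr.monotone (sup_le hy hz)
    _ ≤ I.ncard := by rw [← ht]; exact Set.ncard_le_ncard Set.inter_subset_left
    _ ≤ (nbrs A I).ncard :=
      (isPartialTransversal_iff_hall A I).1 ((hA I).1 hIi) I subset_rfl
    _ ≤ _ := by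
      refine Set.ncard_le_ncard ?_
      rintro i ⟨a, hai, haI⟩
      rcases hI.subset haI with h | h
      · exact Or.inl ⟨a, hai, h, hIi.label_ne_bot h0 haI⟩
      · exact Or.inr ⟨a, hai, h, hIi.label_ne_bot h0 haI⟩

/-- Three elements that are pairwise far apart but lie in a small join prevent transversality. -/
lemma not_isTransversal_of_rank (hr : StrictMono r) (hπ : ∀ z, r ⊤ + 1 < (π ⁻¹' {z}).ncard)
    {y₁ y₂ y₃ : L} (hlt : r ⊤ + (r y₁ + r y₂ + r y₃) <
      r (y₁ ⊔ y₂) + r (y₁ ⊔ y₃) + r (y₂ ⊔ y₃)) :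
    ¬ (labelMatroid π r h0 hsub).IsTransversal := by
  rintro ⟨n, A, -, hA⟩
  set N : L → Set (Fin n) := fun z => nbrs A (nonbotBelow π z)
  have hup : ∀ z, (N z).ncard ≤ r z := ncard_nbrs_le_rank h0 hA hr hπ
  have hlow : ∀ y z, r (y ⊔ z) ≤ (N y ∪ N z).ncard :=
    rank_sup_le_ncard_nbrs_union h0 hsub hA hr hπ
  have hmono : ∀ z, N z ⊆ N ⊤ := fun z => nbrs_mono A fun a ha => ⟨le_top, ha.2⟩
  have hall : (N y₁ ∪ N y₂ ∪ N y₃).ncard ≤ r ⊤ :=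
    (Set.ncard_le_ncard (Set.union_subset (Set.union_subset (hmono _) (hmono _)) (hmono _))).trans
      (hup ⊤)
  have e12 := Set.ncard_union_add_ncard_inter (N y₁) (N y₂)
  have e13 := Set.ncard_union_add_ncard_inter (N y₁) (N y₃)
  have e23 := Set.ncard_union_add_ncard_inter (N y₂) (N y₃)
  have e := Set.ncard_union_add_ncard_inter (N y₁ ∪ N y₂) (N y₃)
  have e' : ((N y₁ ∪ N y₂) ∩ N y₃).ncard ≤ (N y₁ ∩ N y₃).ncard + (N y₂ ∩ N y₃).ncard := by
    rw [Set.union_inter_distrib_right]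
    exact Set.ncard_union_le _ _
  have l12 := hlow y₁ y₂
  have l13 := hlow y₁ y₃
  have l23 := hlow y₂ y₃
  have u1 := hup y₁
  have u2 := hup y₂
  have u3 := hup y₃
  omega

end

end Labelled

/-! ### A rank function concentrated just above `x` -/

section Rank

variable {L : Type u} [Lattice L]

/-- The height of `z ⊔ x` above `x`, truncated at two. -/
noncomputable def truncHeight (x z : L) : ℕ := by
  classical exact if z ≤ x then 0 else if x ⋖ z ⊔ x then 1 else 2

lemma truncHeight_of_le {x z : L} (h : z ≤ x) : truncHeight x z = 0 := by
  simp [truncHeight, h]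

lemma truncHeight_of_covBy {x z : L} (h : x ⋖ z) : truncHeight x z = 1 := by
  simp [truncHeight, h.lt.not_ge, sup_eq_left.2 h.le, h]

lemma truncHeight_le_two (x z : L) : truncHeight x z ≤ 2 := by
  unfold truncHeight
  split_ifs <;> omega

lemma truncHeight_eq_zero {x z : L} : truncHeight x z = 0 ↔ z ≤ x := by
  unfold truncHeight
  split_ifs <;> simp_all

lemma covBy_of_truncHeight_eq_one {x z : L} (h : truncHeight x z = 1) : x ⋖ z ⊔ x := by
  unfold truncHeight at h
  split_ifs at h
  · assumption
  · omega

lemma sup_eq_of_truncHeight_eq_one {x z w : L} (h : truncHeight x w = 1) (hzw : z ≤ w)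
    (hz : ¬ z ≤ x) : z ⊔ x = w ⊔ x := by
  have hc := covBy_of_truncHeight_eq_one h
  rcases hc.eq_or_eq (le_sup_right : x ≤ z ⊔ x) (sup_le_sup_right hzw x) with h' | h'
  · exact absurd (sup_eq_right.1 h') hz
  · exact h'

lemma truncHeight_mono (x : L) : Monotone (truncHeight x) := by
  intro z w hzw
  by_cases hz : z ≤ x
  · simp [truncHeight_of_le hz]
  have hw : truncHeight x w ≠ 0 := fun h => hz (hzw.trans (truncHeight_eq_zero.1 h))
  have hw2 := truncHeight_le_two x w
  have hz2 := truncHeight_le_two x z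
  by_cases h1 : truncHeight x w = 1
  · have h := sup_eq_of_truncHeight_eq_one h1 hzw hz
    have hc := covBy_of_truncHeight_eq_one h1
    rw [← h] at hc
    rw [h1]
    simp [truncHeight, hz, hc]
  · omega

lemma truncHeight_submodular (x z w : L) :
    truncHeight x (z ⊔ w) + truncHeight x (z ⊓ w) ≤ truncHeight x z + truncHeight x w := by
  have hs2 := truncHeight_le_two x (z ⊔ w)
  have hz := truncHeight_mono x (inf_le_left : z ⊓ w ≤ z)
  have hw := truncHeight_mono x (inf_le_right : z ⊓ w ≤ w)
  have hcongr : ∀ {a b : L}, a ⊔ x = b ⊔ x → truncHeight x a = truncHeight x b := by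
    intro a b h
    have : a ≤ x ↔ b ≤ x := by rw [← sup_eq_right, h, sup_eq_right]
    unfold truncHeight
    rw [h]
    by_cases hb : b ≤ x
    · rw [if_pos hb, if_pos (this.2 hb)]
    · rw [if_neg hb, if_neg (mt this.1 hb)]
  by_cases hz0 : z ≤ x
  · have : truncHeight x (z ⊔ w) = truncHeight x w :=
      hcongr (by rw [sup_comm z w, sup_assoc, sup_eq_right.2 hz0])
    omega
  by_cases hw0 : w ≤ x
  · have : truncHeight x (z ⊔ w) = truncHeight x z :=
      hcongr (by rw [sup_assoc, sup_eq_right.2 hw0])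
    omega
  have hz0' := mt truncHeight_eq_zero.1 hz0
  have hw0' := mt truncHeight_eq_zero.1 hw0
  have hz2 := truncHeight_le_two x z
  have hw2 := truncHeight_le_two x w
  by_cases hi : z ⊓ w ≤ x
  · rw [truncHeight_of_le hi]
    omega
  -- The critical case: since `z ⊓ w` is not below `x`, it, `z` and `w` all have the same join with
  -- `x`.
  by_cases h1 : truncHeight x z = 1 ∧ truncHeight x w = 1
  · have h2 := (sup_eq_of_truncHeight_eq_one h1.1 inf_le_left hi).symm.trans
      (sup_eq_of_truncHeight_eq_one h1.2 inf_le_right hi)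
    have : truncHeight x (z ⊔ w) = truncHeight x w :=
      hcongr (by rw [sup_sup_distrib_right, h2, sup_idem])
    omega
  · omega

lemma truncHeight_sup_of_covBy {x y z : L} (hy : x ⋖ y) (hz : x ⋖ z) (hne : y ≠ z) :
    truncHeight x (y ⊔ z) = 2 := by
  have h2 := truncHeight_le_two x (y ⊔ z)
  have h0 : truncHeight x (y ⊔ z) ≠ 0 :=
    fun h => hy.lt.not_ge (le_sup_left.trans (truncHeight_eq_zero.1 h))
  have h1 : truncHeight x (y ⊔ z) ≠ 1 := by
    intro h
    have hy' := sup_eq_of_truncHeight_eq_one h le_sup_left hy.lt.not_ge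
    have hz' := sup_eq_of_truncHeight_eq_one h le_sup_right hz.lt.not_ge
    rw [sup_eq_left.2 hy.le] at hy'
    rw [sup_eq_left.2 hz.le] at hz'
    exact hne (hy'.trans hz'.symm)
  omega

/-- The number of elements that are not above `z`. -/
noncomputable def numNotAbove (z : L) : ℕ := {w : L | ¬ z ≤ w}.ncard

/-- The sets counted for `z` and `w` have as union the set counted for the join, and their
intersection contains that for the meet. -/
lemma numNotAbove_submodular [Finite L] (z w : L) :
    numNotAbove (z ⊔ w) + numNotAbove (z ⊓ w) ≤ numNotAbove z + numNotAbove w := by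
  unfold numNotAbove
  rw [← Set.ncard_union_add_ncard_inter {u | ¬ z ≤ u} {u | ¬ w ≤ u}]
  refine add_le_add (Set.ncard_le_ncard fun u hu => ?_) (Set.ncard_le_ncard fun u hu => ?_)
  · by_cases hz : z ≤ u
    · exact Or.inr fun hw => hu (sup_le hz hw)
    · exact Or.inl hz
  · exact ⟨fun h => hu (inf_le_left.trans h), fun h => hu (inf_le_right.trans h)⟩

lemma numNotAbove_strictMono [Finite L] : StrictMono (numNotAbove : L → ℕ) := by
  intro z w h
  refine Set.ncard_lt_ncard ⟨fun u hu hw => hu (h.le.trans hw), fun hss => ?_⟩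
  exact hss (show z ∈ {u | ¬ w ≤ u} from h.not_ge) le_rfl

lemma numNotAbove_le_card [Finite L] (z : L) : numNotAbove z ≤ Nat.card L :=
  Set.ncard_le_card _

end Rank

end Matroid

open Matroid in
/-- If `x` has three covers, then some matroid whose lattice of cyclic flats is `L` is not
transversal. -/
lemma not_isTrLattice_of_covBy {L : Type u} [Lattice L] [Finite L] {x y₁ y₂ y₃ : L} (h₁ : x ⋖ y₁)
    (h₂ : x ⋖ y₂) (h₃ : x ⋖ y₃) (h₁₂ : y₁ ≠ y₂) (h₁₃ : y₁ ≠ y₃) (h₂₃ : y₂ ≠ y₃) :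
    ¬ IsTrLattice.{u, v} L := by
  intro hL
  have : Nonempty L := ⟨x⟩
  have := Fintype.ofFinite L
  let _ : BoundedOrder L := Fintype.toBoundedOrder L
  set m := Nat.card L
  -- The perturbation adds at most `m` at each of the three covers and `⊤`, so `4 * m + 1` outweighs
  -- it.
  let r : L → ℕ := fun z => (4 * m + 1) * truncHeight x z + numNotAbove z
  have h0 : r ⊥ = 0 := by simp [r, truncHeight_of_le, numNotAbove]
  have hsub : ∀ z w, r (z ⊔ w) + r (z ⊓ w) ≤ r z + r w := by
    intro z w
    have h1 := Nat.mul_le_mul_left (4 * m + 1) (truncHeight_submodular x z w)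
    have h2 := numNotAbove_submodular z w
    simp only [r]
    rw [mul_add, mul_add] at h1
    omega
  have hr : StrictMono r := fun z w h => add_lt_add_of_le_of_lt
    (Nat.mul_le_mul_left _ (truncHeight_mono x h.le)) (numNotAbove_strictMono h)
  let π : ULift.{v} (Fin m × Fin (r ⊤ + 2)) → L := fun a => (Finite.equivFin L).symm a.down.1
  have hπ : ∀ z, r ⊤ + 1 < (π ⁻¹' {z}).ncard := by
    intro z
    let f : Fin (r ⊤ + 2) → ULift.{v} (Fin m × Fin (r ⊤ + 2)) := fun j =>
      ⟨(Finite.equivFin L z, j)⟩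
    have hf : Function.Injective f := fun i j h => by simpa [f] using h
    have h1 : f '' Set.univ ⊆ π ⁻¹' {z} := by
      rintro _ ⟨j, -, rfl⟩
      simp [π, f]
    have h2 := Set.ncard_le_ncard h1
    rw [Set.ncard_image_of_injective _ hf, Set.ncard_univ, Nat.card_eq_fintype_card,
      Fintype.card_fin] at h2
    omega
  refine not_isTransversal_of_rank h0 hsub hr hπ (y₁ := y₁) (y₂ := y₂) (y₃ := y₃) ?_
    (hL _ _ (labelMatroid_finite h0 hsub) (labelMatroid_nonempty_orderIso h0 hsub hr hπ))
  have b1 := numNotAbove_le_card y₁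
  have b2 := numNotAbove_le_card y₂
  have b3 := numNotAbove_le_card y₃
  have bt := numNotAbove_le_card (⊤ : L)
  have ht := Nat.mul_le_mul_left (4 * m + 1) (truncHeight_le_two x ⊤)
  simp only [r, truncHeight_of_covBy h₁, truncHeight_of_covBy h₂, truncHeight_of_covBy h₃,
    truncHeight_sup_of_covBy h₁ h₂ h₁₂, truncHeight_sup_of_covBy h₁ h₃ h₁₃,
    truncHeight_sup_of_covBy h₂ h₃ h₂₃]
  omega

theorem mainTheorem2 (L : Type u) [Lattice L] [Finite L] (hL : IsTrLattice.{u, v} L) (x : L) :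
    {y : L | x ⋖ y}.encard ≤ 2 := by
  by_contra h
  rw [not_le, ← (Set.toFinite {y : L | x ⋖ y}).cast_ncard_eq] at h
  obtain ⟨y₁, y₂, y₃, h₁, h₂, h₃, h₁₂, h₁₃, h₂₃⟩ :=
    (Set.two_lt_ncard_iff (Set.toFinite {y : L | x ⋖ y})).1 (by exact_mod_cast h)
  exact not_isTrLattice_of_covBy h₁ h₂ h₃ h₁₂ h₁₃ h₂₃ hL
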